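/- Let $G$ be an abelian group (not necessarily finite), and let $A$ be a sequence over $G$, that is, a finite multiset of elements of $G$, of length $|A|$ (terms counted with multiplicity). Let $S(A)\subseteq G$ be the set of elements appearing in $A$, let $S_2(A)$ be the set of elements appearing at least twice in $A$, and let $k\wedge A\subseteq G$ be the set of all sums of $k$-term subsequences (sub-multisets with $k$ terms, counted with multiplicity) of $A$. Suppose that $|A|>|S(A)|$ and let $k$ be an integer with $2\leqslant k\leqslant |A|-2$. Then $$|k\wedge A|\geqslant |S(A)|,$$ with equality if and only if one of the following holds: (i) $S(A)$ is a coset of a subgroup of $G$; (ii) $|S(A)|=2$ and $|S_2(A)|=1$; (iii) $S(A)$ is an arithmetic progression of length three, i.e. $S(A)=\{a,a+d,a+2d\}$ for some $a,d\in G$ with these three elements distinct, and $S_2(A)=\{a+d\}$, i.e. the middle term is the only repeated element. -/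

import Mathlib

open scoped Pointwise

/-- `kSums k A` is `k ∧ A`: the set of sums of the `k`-term subsequences of the sequence `A`
(a finite multiset), terms being taken with multiplicity at most that in `A`. -/
def kSums {G : Type*} [AddCommGroup G] [DecidableEq G] (k : ℕ) (A : Multiset G) : Finset G :=
  ((A.powersetCard k).map Multiset.sum).toFinset

/-- `seqSupport A` is `S(A)`, the set of elements appearing in `A`. -/
def seqSupport {G : Type*} [DecidableEq G] (A : Multiset G) : Finset G :=
  A.toFinset

/-- `repeated j A` is `S_j(A)`, the set of elements appearing at least `j` times in `A`
(meant for `1 ≤ j`). -/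
def repeated {G : Type*} [DecidableEq G] (j : ℕ) (A : Multiset G) : Finset G :=
  A.toFinset.filter fun g => j ≤ A.count g

/-- `S` is a coset of a subgroup of `G`. -/
def IsSubgroupCoset {G : Type*} [AddCommGroup G] (S : Set G) : Prop :=
  ∃ (H : AddSubgroup G) (g : G), S = g +ᵥ (H : Set G)

theorem mem_kSums {G : Type*} [AddCommGroup G] [DecidableEq G] {k : ℕ} {A : Multiset G} {g : G} :
    g ∈ kSums k A ↔ ∃ B : Multiset G, B ≤ A ∧ B.card = k ∧ B.sum = g := by
  simp [kSums, Multiset.mem_powersetCard, and_assoc]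

/-!
Write `S = S(A)`, `m = |S|`, `n = |A|` and `K = k ∧ A`. The three extremal shapes visibly give
`|K| ≤ m` (`IsExtremal.card_kSums_le`), so the content is that `m ≤ |K|`, and that `|K| ≤ m` forces
an extremal shape. This pair of claims (`KSumsBound`) is invariant under translating `A`, and under
`k ↦ n - k`, because complementary subsequences have complementary sums. It is proved by strong
induction on `n` (`kSumsBound_of_card_lt`).

If `k = 2`, translate a repeated term to `0`. Then `K ⊇ 0 + S`, and equality says that `S` is closed
under sums of distinct elements and under doubling of repeated ones. Such a set is a subgroup or is
contained in some `{0, a, -a}` (`subset_of_add_self_notMem`).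

If `n ≥ m + 2`, deleting a term of large multiplicity leaves `S` unchanged and reduces `k` to
`k - 1` (`kSumsBound_of_erase`).

The main case is `n = m + 1`, when `A` is, after translation, a finite set `S ∋ 0` together with one
more `0`, and `3 ≤ k ≤ n / 2` (`kSumsBound_zero_cons`). Suppose `|K| ≤ m`. For nonzero `x ≠ y` in
`S` let `Z` be the set of `(k - 1)`-sums of `A` without `x` and `y`, so that `x + Z` and `y + Z` lie
in `K`. By induction `|Z| ≥ m - 1` unless `A` without `x` and `y` is extremal, which is treated
separately. Hence translation by `x - y` moves at most one element of `K` out of `K`. The translates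
of `K` by the differences `x - x₀` then pairwise meet in all but at most one element. A family of
that kind lies in a common set with one more element or contains a common set with one element less,
and it follows that all these differences stabilise `K`, or `K` with one point added, or `K` with
one point deleted (`exists_stable_of_almost_stable`). The stable set is smaller than twice the
number `m - 1` of differences, so it is a single coset of a subgroup `H`. The first possibility
gives `S = H`. In the second `S` misses at most one element of `H` and `K` would be all of `H`
(`mem_kSums_of_card_le`), and in the third `K` would meet another coset of `H` twice
(`isSubgroupCoset_of_almost_stable`).
-/

/-! ### Sets closed under sums of distinct elements -/

theorem add_mem_iff_of_forall_add_mem {G : Type*} [AddCommGroup G]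
    {K : Finset G} {d : G} (h : ∀ g ∈ K, g + d ∈ K) (g : G) : g + d ∈ K ↔ g ∈ K := by
  classical
  refine ⟨fun hg => ?_, h g⟩
  have hsub : K.image (· + d) ⊆ K := Finset.image_subset_iff.2 h
  have heq := Finset.eq_of_subset_of_card_le hsub
    (Finset.card_image_of_injective K (add_left_injective d)).ge
  rw [← heq] at hg
  obtain ⟨x, hx, hxg⟩ := Finset.mem_image.1 hg
  exact add_right_cancel hxg ▸ hx

theorem neg_mem_of_add_self_mem {G : Type*} [AddCommGroup G]
    {S : Finset G} (hS : ∀ a ∈ S, ∀ b ∈ S, a ≠ b → a + b ∈ S) {c : G}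
    (hc : c ∈ S) (hcc : c + c ∈ S) : -c ∈ S := by
  have h : ∀ g ∈ S, g + c ∈ S := by
    intro g hg
    by_cases hgc : g = c
    · exact hgc ▸ hcc
    · exact hS g hg c hc hgc
  have h' := add_mem_iff_of_forall_add_mem h
  exact (h' _).1 ((h' _).1 (by simpa using hc))

theorem false_of_add_self_mem {G : Type*} [AddCommGroup G]
    {S : Finset G} (hS : ∀ a ∈ S, ∀ b ∈ S, a ≠ b → a + b ∈ S) (h0 : (0 : G) ∈ S)
    {a b : G} (ha : a ∈ S) (haa : a + a ∉ S) (hb : b ∈ S) (hbb : b + b ∈ S)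
    (hb0 : b ≠ 0) (hba : b ≠ a) (hbn : b ≠ -a) : False := by
  have ha0 : a ≠ 0 := by rintro rfl; simp [h0] at haa
  -- it is enough to have `c`, `-c` and `c + 2a` in `S` with `-c ≠ c + 2a`
  have key : ∀ c ∈ S, -c ∈ S → c ≠ 0 → c ≠ a → c + c + (a + a) ≠ 0 → False := by
    intro c hc hcn hc0 hca hne
    have h1 : c + a ∈ S := hS c hc a ha hca
    have h2 : c + a + a ∈ S := hS _ h1 a ha (by simpa using hc0)
    have h3 := hS _ h2 _ hcn (fun h => hne (by
      calc c + c + (a + a) = (c + a + a) + c := by abel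
        _ = 0 := by rw [h]; abel))
    exact haa (by convert h3 using 1; abel)
  have hbneg := neg_mem_of_add_self_mem hS hb hbb
  by_cases hz : b + b + (a + a) = 0
  · have h1 : b + a ∈ S := hS b hb a ha hba
    have h2 : (b + a) + (b + a) = 0 := by rw [← hz]; abel
    have h3 : -(b + a) ∈ S := neg_mem_of_add_self_mem hS h1 (by rw [h2]; exact h0)
    refine key (b + a) h1 h3 (fun h => hbn (eq_neg_of_add_eq_zero_left h)) (by simpa using hb0) ?_
    rw [h2, zero_add]
    exact fun h => haa (h ▸ h0)
  · exact key b hb hbneg hb0 hba hz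

/-- A finite set containing `0` and closed under sums of two distinct elements is closed under
doubling too, unless it has at most three elements. -/
theorem subset_of_add_self_notMem {G : Type*} [AddCommGroup G]
    {S : Finset G} (hS : ∀ a ∈ S, ∀ b ∈ S, a ≠ b → a + b ∈ S) (h0 : (0 : G) ∈ S)
    {a : G} (ha : a ∈ S) (haa : a + a ∉ S) : ∀ b ∈ S, b = 0 ∨ b = a ∨ b = -a := by
  have ha0 : a ≠ 0 := by rintro rfl; simp [h0] at haa
  have haa0 : a + a ≠ 0 := fun h => haa (h ▸ h0)
  intro b hb
  by_contra! hcon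
  obtain ⟨hb0, hba, hbn⟩ := hcon
  by_cases hbb : b + b ∈ S
  · exact false_of_add_self_mem hS h0 ha haa hb hbb hb0 hba hbn
  have h1 : b + a ∈ S := hS b hb a ha hba
  have h2 : b + a + a ∈ S := hS _ h1 a ha (by simpa using hb0)
  have h3 : b + (b + a + a) ∈ S := hS b hb _ h2 (by
    intro h; exact haa0 (by simpa [add_assoc] using h.symm))
  by_cases hbn' : b + a = -a
  · -- here `b = -2a`, and the successive sums `-3a`, `-4a = 2b` stay in `S`
    have h4 : b + -a ∈ S := hS b hb _ (hbn' ▸ h1) hbn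
    refine hbb ?_
    have h5 := hS _ h4 _ (hbn' ▸ h1) (fun h => hb0 (by simpa using h))
    convert h5 using 1
    have : b = -a - a := by rw [← hbn']; abel
    rw [this]; abel
  · exact false_of_add_self_mem hS h0 ha haa h1 (by convert h3 using 1; abel)
      (fun h => hbn (eq_neg_of_add_eq_zero_left h)) (by simpa using hb0) hbn'

/-! ### Almost stable sets -/

/-- If every translate of `K` by a difference of elements of `D` loses at most one element of `K`,
then `D` stabilises `K` up to adding or deleting one point. The translates of `K` by `D` pairwise
share all but one element, so they lie in a common set with one more element or contain a common
set with one element less. -/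
theorem exists_stable_of_almost_stable {G : Type*} [AddCommGroup G] [DecidableEq G]
    {K D : Finset G} (h0 : (0 : G) ∈ D) (hD : 3 ≤ D.card)
    (hP : ∀ d ∈ D, ∀ e ∈ D, ∀ p ∈ K, ∀ q ∈ K, p + (d - e) ∉ K → q + (d - e) ∉ K → p = q) :
    ∃ Γ : Finset G, (Γ = K ∨ (∃ f, f ∉ K ∧ Γ = insert f K) ∨ ∃ u ∈ K, Γ = K.erase u) ∧
      ∀ d ∈ D, ∀ g, g + d ∈ Γ ↔ g ∈ Γ := by
  by_cases hper : ∃ h, h ≠ 0 ∧ ∀ g ∈ K, g + h ∈ K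
  · obtain ⟨h, hh0, hh⟩ := hper
    refine ⟨K, Or.inl rfl, fun d hd => add_mem_iff_of_forall_add_mem fun g hg => ?_⟩
    by_contra hgd
    have hit := add_mem_iff_of_forall_add_mem hh
    have := hP d hd 0 h0 g hg (g + h) (hh g hg) (by simpa using hgd) (by
      intro hc
      refine hgd ((hit _).1 ?_)
      convert hc using 1
      abel)
    exact hh0 (by simpa using this)
  push Not at hper
  have hf : ∀ d, ∃ f, d ∈ D → d ≠ 0 → f ∉ K ∧ f - d ∈ K ∧ ∀ g ∈ K, g + d ∈ K ∨ g + d = f := by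
    intro d
    by_cases hd : d ∈ D ∧ d ≠ 0
    · obtain ⟨p, hp, hpd⟩ := hper d hd.2
      refine ⟨p + d, fun _ _ => ⟨hpd, by simpa using hp, fun g hg => ?_⟩⟩
      by_cases hgd : g + d ∈ K
      · exact Or.inl hgd
      · right
        rw [hP d hd.1 0 h0 g hg p hp (by simpa using hgd) (by simpa using hpd)]
    · exact ⟨0, fun h1 h2 => absurd ⟨h1, h2⟩ hd⟩
  have hu : ∀ d, ∃ u, d ∈ D → d ≠ 0 → u ∈ K ∧ u - d ∉ K ∧ ∀ g ∈ K, g - d ∈ K ∨ g = u := by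
    intro d
    by_cases hd : d ∈ D ∧ d ≠ 0
    · obtain ⟨p, hp, hpd⟩ := hper (-d) (neg_ne_zero.2 hd.2)
      rw [← sub_eq_add_neg] at hpd
      refine ⟨p, fun _ _ => ⟨hp, hpd, fun g hg => ?_⟩⟩
      by_cases hgd : g - d ∈ K
      · exact Or.inl hgd
      · right
        refine hP 0 h0 d hd.1 g hg p hp ?_ ?_ <;> rwa [zero_sub, ← sub_eq_add_neg]
    · exact ⟨0, fun h1 h2 => absurd ⟨h1, h2⟩ hd⟩
  choose f hf using hf
  choose u hu using hu
  have hpair : ∀ d ∈ D, d ≠ 0 → ∀ e ∈ D, e ≠ 0 → f d = f e ∨ u d = u e := by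
    intro d hd hd0 e he he0
    by_contra! hcon
    obtain ⟨f1, f2, f3⟩ := hf d hd hd0
    obtain ⟨g1, g2, g3⟩ := hf e he he0
    obtain ⟨u1, u2, u3⟩ := hu d hd hd0
    obtain ⟨v1, v2, v3⟩ := hu e he he0
    have a1 : u e - d ∈ K := (v3 _ v1).elim (fun _ => (u3 _ v1).resolve_right (Ne.symm hcon.2))
      (fun _ => (u3 _ v1).resolve_right (Ne.symm hcon.2))
    have a2 := hP d hd e he _ f2 _ a1 (by
      intro hc
      rcases g3 _ hc with h | h
      · exact f1 (by convert h using 1; abel)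
      · exact hcon.1 (by rw [← h]; abel)) (by
      intro hc
      exact v2 (by convert hc using 1; abel))
    exact f1 ((sub_left_injective a2 : f d = u e) ▸ v1)
  -- two distinct nonzero translations available
  obtain ⟨d₁, hd₁, d₂, hd₂, hne⟩ : ∃ d₁ ∈ D.erase 0, ∃ d₂ ∈ D.erase 0, d₁ ≠ d₂ := by
    refine Finset.one_lt_card.1 ?_
    rw [Finset.card_erase_of_mem h0]; omega
  rw [Finset.mem_erase] at hd₁ hd₂
  -- one point `w` completing `K'` to a set stable under the translations
  have complete : ∀ (K' : Finset G) (w : G) (E : Finset G), w ∉ K' →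
      (∃ e₁ ∈ E, ∃ e₂ ∈ E, e₁ ≠ e₂) →
      (∀ e ∈ E, w - e ∈ K' ∧ ∀ g ∈ K', g + e ∈ K' ∨ g + e = w) →
      ∀ e ∈ E, ∀ g ∈ insert w K', g + e ∈ insert w K' := by
    intro K' w E hw hE hK e he
    have hmem : ∀ e ∈ E, ∀ g ∈ K', g + e ∈ insert w K' := by
      intro e he g hg
      rcases (hK e he).2 g hg with h | h
      · exact Finset.mem_insert_of_mem h
      · exact h ▸ Finset.mem_insert_self _ _
    suffices hwe : w + e ∈ insert w K' by
      intro g hg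
      rcases Finset.mem_insert.1 hg with rfl | hg
      · exact hwe
      · exact hmem e he g hg
    obtain ⟨e', he', hee⟩ : ∃ e' ∈ E, e' ≠ e := by
      obtain ⟨e₁, h₁, e₂, h₂, hn⟩ := hE
      by_cases h : e₁ = e
      · exact ⟨e₂, h₂, fun h' => hn (h.trans h'.symm)⟩
      · exact ⟨e₁, h₁, h⟩
    by_contra hwe
    have b1 : w - e + e' ∈ K' := by
      rcases (hK e' he').2 _ (hK e he).1 with h | h
      · exact h
      · exact absurd (by simpa [sub_add, sub_eq_self, sub_eq_zero] using h : e = e').symm hee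
    have b2 : w + e' ∈ insert w K' := by
      have := hmem e he _ b1
      convert this using 1
      abel
    have b3 : ∀ g ∈ insert w K', g + e' ∈ insert w K' := by
      intro g hg
      rcases Finset.mem_insert.1 hg with rfl | hg
      · exact b2
      · exact hmem e' he' g hg
    have b4 := b3 _ (hmem e he _ (hK e' he').1)
    exact hwe (by convert b4 using 1; abel)
  by_cases hfc : ∀ d ∈ D, d ≠ 0 → f d = f d₁
  · have hf1 := hf d₁ hd₁.2 hd₁.1
    refine ⟨insert (f d₁) K, Or.inr (Or.inl ⟨_, hf1.1, rfl⟩), fun d hd =>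
      add_mem_iff_of_forall_add_mem ?_⟩
    by_cases hd0 : d = 0
    · simp [hd0]
    refine complete K (f d₁) (D.erase 0) hf1.1
      ⟨d₁, Finset.mem_erase.2 hd₁, d₂, Finset.mem_erase.2 hd₂, hne⟩ ?_ d (Finset.mem_erase.2 ⟨hd0, hd⟩)
    intro e he
    rw [Finset.mem_erase] at he
    have := hf e he.2 he.1
    rw [hfc e he.2 he.1] at this
    exact this.2
  · push Not at hfc
    obtain ⟨d₀, hd₀, hd₀0, hfd₀⟩ := hfc
    have hu0 := hu d₁ hd₁.2 hd₁.1
    have huc : ∀ d ∈ D, d ≠ 0 → u d = u d₁ := by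
      intro d hd hd0
      have h1 := hpair d hd hd0 d₁ hd₁.2 hd₁.1
      have h2 := hpair d hd hd0 d₀ hd₀ hd₀0
      have h3 := hpair d₀ hd₀ hd₀0 d₁ hd₁.2 hd₁.1
      rcases h1 with h1 | h1
      · rcases h2 with h2 | h2
        · exact absurd (h2.symm.trans h1) hfd₀
        · exact h2.trans (h3.resolve_left hfd₀)
      · exact h1
    set w := u d₁ with hw
    have hins : insert w (K.erase w) = K := Finset.insert_erase hu0.1
    have hmove : ∀ d ∈ D, d ≠ 0 → ∀ g ∈ K.erase w, g + -d ∈ K.erase w ∨ g + -d = w := by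
      intro d hd hd0 g hg
      have h1 := (hu d hd hd0).2.2 g (Finset.mem_of_mem_erase hg)
      rw [huc d hd hd0] at h1
      have h2 := h1.resolve_right (Finset.ne_of_mem_erase hg)
      rw [← sub_eq_add_neg]
      by_cases h3 : g - d = w
      · exact Or.inr h3
      · exact Or.inl (Finset.mem_erase.2 ⟨h3, h2⟩)
    by_cases hall : ∀ d ∈ D, d ≠ 0 → w - -d ∈ K.erase w
    · -- then `K` itself would be stable
      exfalso
      have := complete (K.erase w) w ((D.erase 0).image Neg.neg) (Finset.notMem_erase _ _)
        ⟨-d₁, Finset.mem_image_of_mem _ (Finset.mem_erase.2 hd₁), -d₂,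
          Finset.mem_image_of_mem _ (Finset.mem_erase.2 hd₂), by simpa using hne⟩ (by
          intro e he
          obtain ⟨d, hd, rfl⟩ := Finset.mem_image.1 he
          rw [Finset.mem_erase] at hd
          exact ⟨hall d hd.2 hd.1, hmove d hd.2 hd.1⟩) (-d₁)
        (Finset.mem_image_of_mem _ (Finset.mem_erase.2 hd₁))
      rw [hins] at this
      obtain ⟨g, hg, hg'⟩ := hper (-d₁) (neg_ne_zero.2 hd₁.1)
      exact hg' (this g hg)
    · push Not at hall
      obtain ⟨e, he, he0, hwe⟩ := hall
      have hstab : ∀ g ∈ K.erase w, g + -e ∈ K.erase w := by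
        intro g hg
        refine (hmove e he he0 g hg).resolve_right fun h => hwe ?_
        have hwg : w - -e = g := by rw [← h]; abel
        rwa [hwg]
      refine ⟨K.erase w, Or.inr (Or.inr ⟨w, hu0.1, rfl⟩), fun d hd => ?_⟩
      by_cases hd0 : d = 0
      · simp [hd0]
      have hst : ∀ g ∈ K.erase w, g + -d ∈ K.erase w := by
        intro g hg
        refine (hmove d hd hd0 g hg).resolve_right fun h => ?_
        -- otherwise `w` could be moved back into `K.erase w` by `-e`
        have h1 := hmove d hd hd0 _ (hstab g hg)
        have h2 : g + -e + -d = w + -e := by rw [← h]; abel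
        rw [h2] at h1
        rcases h1 with h1 | h1
        · have := (add_mem_iff_of_forall_add_mem hstab w).1 h1
          exact Finset.notMem_erase _ _ this
        · exact he0 (by simpa using h1)
      intro g
      have := add_mem_iff_of_forall_add_mem hst (g + d)
      rw [add_neg_cancel_right] at this
      exact this.symm

/-! ### Sets of `k`-sums -/

theorem isSubgroupCoset_iff {G : Type*} [AddCommGroup G] {S : Set G} :
    IsSubgroupCoset S ↔ ∃ (H : AddSubgroup G) (g : G), ∀ x, x ∈ S ↔ x - g ∈ H := by
  simp only [IsSubgroupCoset, Set.ext_iff, Set.mem_vadd_set_iff_neg_vadd_mem, vadd_eq_add,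
    SetLike.mem_coe, neg_add_eq_sub]

theorem mem_seqSupport {G : Type*} [DecidableEq G] {A : Multiset G} {x : G} :
    x ∈ seqSupport A ↔ x ∈ A := Multiset.mem_toFinset

theorem mem_repeated_two {G : Type*} [DecidableEq G] {A : Multiset G} {x : G} :
    x ∈ repeated 2 A ↔ 2 ≤ A.count x := by
  rw [repeated, Finset.mem_filter, Multiset.mem_toFinset]
  exact ⟨And.right, fun h => ⟨Multiset.count_pos.1 (by omega), h⟩⟩

theorem kSums_mono {G : Type*} [AddCommGroup G] [DecidableEq G] {k : ℕ} {A B : Multiset G}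
    (h : A ≤ B) : kSums k A ⊆ kSums k B := by
  intro g hg
  obtain ⟨C, hC, hk, hs⟩ := mem_kSums.1 hg
  exact mem_kSums.2 ⟨C, hC.trans h, hk, hs⟩

theorem add_mem_kSums {G : Type*} [AddCommGroup G] [DecidableEq G] {k : ℕ} {A B : Multiset G}
    {x g : G} (h : x ::ₘ A ≤ B) (hg : g ∈ kSums k A) : x + g ∈ kSums (k + 1) B := by
  obtain ⟨C, hC, hk, hs⟩ := mem_kSums.1 hg
  exact mem_kSums.2 ⟨x ::ₘ C, ((Multiset.cons_le_cons_iff x).2 hC).trans h, by simp [hk],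
    by simp [hs]⟩

theorem card_kSums_sub_le {G : Type*} [AddCommGroup G] [DecidableEq G] {k : ℕ} {A : Multiset G} :
    (kSums k A).card ≤ (kSums (A.card - k) A).card := by
  refine Finset.card_le_card_of_injOn (fun g => A.sum - g) ?_ (sub_right_injective.injOn)
  intro g hg
  obtain ⟨C, hC, hk, hs⟩ := mem_kSums.1 hg
  refine mem_kSums.2 ⟨A - C, tsub_le_self, by rw [Multiset.card_sub hC, hk], ?_⟩
  have := congrArg Multiset.sum (tsub_add_cancel_of_le hC)
  rw [Multiset.sum_add, hs] at this
  exact eq_sub_of_add_eq this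

/-- Passing to complements exchanges `k` and `|A| - k`. -/
theorem card_kSums_sub {G : Type*} [AddCommGroup G] [DecidableEq G] {k : ℕ} {A : Multiset G}
    (hk : k ≤ A.card) : (kSums (A.card - k) A).card = (kSums k A).card := by
  refine le_antisymm ?_ card_kSums_sub_le
  have := card_kSums_sub_le (k := A.card - k) (A := A)
  rwa [Nat.sub_sub_self hk] at this

theorem card_kSums_le_map_add {G : Type*} [AddCommGroup G] [DecidableEq G] {k : ℕ}
    (A : Multiset G) (c : G) : (kSums k A).card ≤ (kSums k (A.map (· + c))).card := by
  refine Finset.card_le_card_of_injOn (fun g => g + k • c) ?_ ((add_left_injective _).injOn)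
  intro g hg
  obtain ⟨C, hC, hk, hs⟩ := mem_kSums.1 hg
  refine mem_kSums.2 ⟨C.map (· + c), Multiset.map_le_map hC, by simp [hk], ?_⟩
  simp [Multiset.sum_map_add, hs, hk]

theorem map_add_map_neg {G : Type*} [AddCommGroup G] (A : Multiset G) (c : G) :
    (A.map (· + c)).map (· + -c) = A := by
  simp [Multiset.map_map]

theorem card_kSums_map_add {G : Type*} [AddCommGroup G] [DecidableEq G] {k : ℕ}
    (A : Multiset G) (c : G) : (kSums k (A.map (· + c))).card = (kSums k A).card := by
  refine le_antisymm ?_ (card_kSums_le_map_add A c)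
  have := card_kSums_le_map_add (k := k) (A.map (· + c)) (-c)
  rwa [map_add_map_neg] at this

theorem mem_map_add {G : Type*} [AddCommGroup G] {A : Multiset G} {c x : G} :
    x + c ∈ A.map (· + c) ↔ x ∈ A :=
  Multiset.mem_map_of_injective (add_left_injective c)

theorem count_map_add {G : Type*} [AddCommGroup G] [DecidableEq G] (A : Multiset G) (c x : G) :
    (A.map (· + c)).count (x + c) = A.count x :=
  Multiset.count_map_eq_count' _ _ (add_left_injective c) x

theorem seqSupport_map_add {G : Type*} [AddCommGroup G] [DecidableEq G] (A : Multiset G) (c : G) :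
    seqSupport (A.map (· + c)) = (seqSupport A).image (· + c) := by
  rw [seqSupport, Multiset.toFinset_map]; rfl

theorem repeated_map_add {G : Type*} [AddCommGroup G] [DecidableEq G] (A : Multiset G) (c : G) :
    repeated 2 (A.map (· + c)) = (repeated 2 A).image (· + c) := by
  ext x
  obtain ⟨y, rfl⟩ : ∃ y, x = y + c := ⟨x - c, by simp⟩
  rw [mem_repeated_two, count_map_add, Finset.mem_image]
  simp [mem_repeated_two]

/-- The three shapes of `A` for which `|k ∧ A| = |S(A)|`. -/
def IsExtremal {G : Type*} [AddCommGroup G] [DecidableEq G] (A : Multiset G) : Prop :=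
  IsSubgroupCoset (seqSupport A : Set G) ∨
    ((seqSupport A).card = 2 ∧ (repeated 2 A).card = 1) ∨
    (∃ a d : G, (seqSupport A).card = 3 ∧ seqSupport A = {a, a + d, a + 2 • d} ∧
      repeated 2 A = {a + d})

theorem IsExtremal.map_add {G : Type*} [AddCommGroup G] [DecidableEq G] {A : Multiset G}
    (h : IsExtremal A) (c : G) : IsExtremal (A.map (· + c)) := by
  have hinj := add_left_injective c
  rcases h with h | ⟨h1, h2⟩ | ⟨a, d, h1, h2, h3⟩
  · left
    obtain ⟨H, g, hg⟩ := isSubgroupCoset_iff.1 h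
    refine isSubgroupCoset_iff.2 ⟨H, g + c, fun x => ?_⟩
    have h1 := hg (x - c)
    have h2 := mem_map_add (A := A) (c := c) (x := x - c)
    rw [sub_add_cancel] at h2
    rw [show x - (g + c) = x - c - g by abel, ← h1, Finset.mem_coe, Finset.mem_coe,
      mem_seqSupport, mem_seqSupport, h2]
  · right; left
    rw [seqSupport_map_add, repeated_map_add, Finset.card_image_of_injective _ hinj,
      Finset.card_image_of_injective _ hinj]
    exact ⟨h1, h2⟩
  · right; right
    refine ⟨a + c, d, ?_, ?_, ?_⟩
    · rwa [seqSupport_map_add, Finset.card_image_of_injective _ hinj]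
    · rw [seqSupport_map_add, h2]
      simp only [Finset.image_insert, Finset.image_singleton]
      rw [add_right_comm a d c, add_right_comm a (2 • d) c]
    · rw [repeated_map_add, h3, Finset.image_singleton, add_right_comm]

/-- The lower bound on `|k ∧ A|` together with the structure in the case of equality. -/
def KSumsBound {G : Type*} [AddCommGroup G] [DecidableEq G] (A : Multiset G) (k : ℕ) : Prop :=
  (seqSupport A).card ≤ (kSums k A).card ∧
    ((kSums k A).card ≤ (seqSupport A).card → IsExtremal A)

theorem KSumsBound.of_map_add {G : Type*} [AddCommGroup G] [DecidableEq G] {A : Multiset G} {k : ℕ}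
    (c : G) (h : KSumsBound (A.map (· + c)) k) : KSumsBound A k := by
  rw [KSumsBound, card_kSums_map_add, seqSupport_map_add,
    Finset.card_image_of_injective _ (add_left_injective c)] at h
  refine ⟨h.1, fun hle => ?_⟩
  have := (h.2 hle).map_add (-c)
  rwa [map_add_map_neg] at this

theorem KSumsBound.of_sub {G : Type*} [AddCommGroup G] [DecidableEq G] {A : Multiset G} {k : ℕ}
    (hk : k ≤ A.card) (h : KSumsBound A (A.card - k)) : KSumsBound A k := by
  rwa [KSumsBound, card_kSums_sub hk] at h

/-! ### Extremal sequences -/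

theorem sum_sub_mem {G : Type*} [AddCommGroup G] (H : AddSubgroup G) (g : G) (B : Multiset G)
    (hB : ∀ b ∈ B, b - g ∈ H) : B.sum - B.card • g ∈ H := by
  induction B using Multiset.induction_on with
  | empty => simp
  | cons b B ih =>
    have h1 := hB b (Multiset.mem_cons_self b B)
    have h2 := ih fun x hx => hB x (Multiset.mem_cons_of_mem hx)
    have h3 := H.add_mem h1 h2
    convert h3 using 1
    rw [Multiset.sum_cons, Multiset.card_cons, add_smul, one_smul]
    abel

theorem sum_eq_card_smul {G : Type*} [AddCommGroup G] {c : G} {B : Multiset G}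
    (hB : ∀ b ∈ B, b = c) : B.sum = B.card • c := by
  conv_lhs => rw [Multiset.eq_replicate_card.2 hB]
  simp

/-- Splitting off an element of multiplicity at most one. -/
theorem notMem_or_exists_cons {G : Type*} [DecidableEq G] {A B : Multiset G} (hBA : B ≤ A) {z : G}
    (hz : A.count z ≤ 1) : z ∉ B ∨ ∃ C, B = z ::ₘ C ∧ z ∉ C := by
  by_cases h : z ∈ B
  · obtain ⟨C, rfl⟩ := Multiset.exists_cons_of_mem h
    refine Or.inr ⟨C, rfl, fun hC => ?_⟩
    have h1 := Multiset.count_le_of_le z hBA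
    have h2 := Multiset.count_pos.2 hC
    rw [Multiset.count_cons_self] at h1
    omega
  · exact Or.inl h

theorem IsExtremal.card_kSums_le {G : Type*} [AddCommGroup G] [DecidableEq G] {A : Multiset G}
    (h : IsExtremal A) (k : ℕ) : (kSums k A).card ≤ (seqSupport A).card := by
  rcases h with h | ⟨h1, h2⟩ | ⟨a, d, h1, h2, h3⟩
  · obtain ⟨H, g, hg⟩ := isSubgroupCoset_iff.1 h
    refine Finset.card_le_card_of_injOn (fun x => x - k • g + g) ?_ ?_
    · intro x hx
      obtain ⟨B, hB, hk, rfl⟩ := mem_kSums.1 hx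
      refine (hg _).2 ?_
      rw [add_sub_cancel_right, ← hk]
      exact sum_sub_mem H g B fun b hb =>
        (hg b).1 (mem_seqSupport.2 (Multiset.mem_of_le hB hb))
    · intro x _ y _ hxy
      simpa using hxy
  · rw [h1]
    obtain ⟨a, ha⟩ := Finset.card_eq_one.1 h2
    have haA : a ∈ seqSupport A := by
      have : a ∈ repeated 2 A := by simp [ha]
      rw [mem_repeated_two] at this
      exact mem_seqSupport.2 (Multiset.count_pos.1 (by omega))
    obtain ⟨b, hb⟩ : ∃ b, (seqSupport A).erase a = {b} := by
      refine Finset.card_eq_one.1 ?_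
      rw [Finset.card_erase_of_mem haA, h1]
    have hab : b ≠ a := Finset.ne_of_mem_erase (hb ▸ Finset.mem_singleton_self b)
    have hmem : ∀ x ∈ A, x ≠ b → x = a := by
      intro x hx hxb
      by_contra hxa
      exact hxb (Finset.mem_singleton.1
        (hb ▸ Finset.mem_erase.2 ⟨hxa, mem_seqSupport.2 hx⟩))
    have hbc : A.count b ≤ 1 := by
      by_contra hcon
      exact hab (Finset.mem_singleton.1 (ha ▸ mem_repeated_two.2 (by omega)))
    refine (Finset.card_le_card (t := {k • a, b + (k - 1) • a}) ?_).trans Finset.card_le_two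
    intro x hx
    obtain ⟨B, hB, hk, rfl⟩ := mem_kSums.1 hx
    rw [Finset.mem_insert, Finset.mem_singleton]
    rcases notMem_or_exists_cons hB hbc with h | ⟨C, rfl, h⟩
    · left
      rw [← hk]
      exact sum_eq_card_smul fun x hx =>
        hmem x (Multiset.mem_of_le hB hx) fun e => h (e ▸ hx)
    · right
      have hC : C.card = k - 1 := by rw [← hk, Multiset.card_cons]; rfl
      rw [Multiset.sum_cons, ← hC, sum_eq_card_smul (c := a) fun x hx =>
        hmem x (Multiset.mem_of_le hB (Multiset.mem_cons_of_mem hx)) fun e => h (e ▸ hx)]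
  · rw [h1]
    have hmem : ∀ x ∈ A, x ≠ a → x ≠ a + 2 • d → x = a + d := by
      intro x hx hx1 hx2
      have := mem_seqSupport.2 hx
      rw [h2] at this
      simp only [Finset.mem_insert, Finset.mem_singleton] at this
      tauto
    have hd : d ≠ 0 := by
      rintro rfl
      simp [h2] at h1
    have hc1 : A.count a ≤ 1 := by
      by_contra hcon
      have := Finset.mem_singleton.1 (h3 ▸ mem_repeated_two.2 (by omega : 2 ≤ A.count a))
      exact hd (by simpa using this)
    have hc2 : A.count (a + 2 • d) ≤ 1 := by
      by_contra hcon
      have := Finset.mem_singleton.1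
        (h3 ▸ mem_repeated_two.2 (by omega : 2 ≤ A.count (a + 2 • d)))
      rw [two_smul] at this
      exact hd (by simpa using this)
    set c := a + d with hc
    have hc' : a + 2 • d = c + d := by rw [hc, two_smul, add_assoc]
    refine (Finset.card_le_card (t := {k • c, k • c + d, k • c - d}) ?_).trans Finset.card_le_three
    intro x hx
    obtain ⟨B, hB, hk, rfl⟩ := mem_kSums.1 hx
    simp only [Finset.mem_insert, Finset.mem_singleton]
    have hconst : ∀ C : Multiset G, C ≤ A → a ∉ C → a + 2 • d ∉ C → C.sum = C.card • c :=
      fun C hC hCa hCd => sum_eq_card_smul fun x hx =>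
        hmem x (Multiset.mem_of_le hC hx) (fun e => hCa (e ▸ hx)) (fun e => hCd (e ▸ hx))
    rcases notMem_or_exists_cons hB hc1 with h | ⟨C, rfl, h⟩
    · rcases notMem_or_exists_cons hB hc2 with h' | ⟨D, rfl, h'⟩
      · left
        rw [hconst B hB h h', hk]
      · right; left
        rw [Multiset.mem_cons, not_or] at h
        rw [Multiset.sum_cons, hconst D ((Multiset.le_cons_self _ _).trans hB) h.2 h', ← hk,
          Multiset.card_cons, add_smul, one_smul, hc']
        abel
    · have hCA := (Multiset.le_cons_self _ _).trans hB
      rcases notMem_or_exists_cons hCA hc2 with h' | ⟨D, rfl, h'⟩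
      · right; right
        rw [Multiset.sum_cons, hconst C hCA h h', ← hk, Multiset.card_cons, add_smul, one_smul, hc]
        abel
      · left
        rw [Multiset.mem_cons, not_or] at h
        rw [Multiset.sum_cons, Multiset.sum_cons,
          hconst D ((Multiset.le_cons_self _ _).trans hCA) h.2 h', ← hk,
          Multiset.card_cons, Multiset.card_cons, add_smul, add_smul, one_smul, hc', hc]
        abel

/-! ### Sums of two terms -/

theorem kSumsBound_two {G : Type*} [AddCommGroup G] [DecidableEq G] {A : Multiset G}
    (hA : (seqSupport A).card < A.card) : KSumsBound A 2 := by
  -- translate a repeated term to `0`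
  obtain ⟨r, hr⟩ : ∃ r, 2 ≤ A.count r := by
    by_contra! hcon
    have : A.Nodup := Multiset.nodup_iff_count_le_one.2 fun a => by have := hcon a; omega
    rw [seqSupport, Multiset.toFinset_card_of_nodup this] at hA
    exact lt_irrefl _ hA
  refine KSumsBound.of_map_add (-r) ?_
  have h0 : 2 ≤ (A.map (· + -r)).count 0 := by
    have := count_map_add A (-r) r
    rw [add_neg_cancel] at this
    rwa [this]
  generalize A.map (· + -r) = B at h0
  have hpair : ∀ x ∈ B, ∀ y ∈ B, x ≠ y → x + y ∈ kSums 2 B := by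
    intro x hx y hy hxy
    refine mem_kSums.2 ⟨{x, y}, ?_, by simp, by simp⟩
    rw [Multiset.insert_eq_cons, Multiset.cons_le_of_notMem (by simpa using hxy)]
    exact ⟨hx, Multiset.singleton_le.2 hy⟩
  have hdouble : ∀ x, 2 ≤ B.count x → x + x ∈ kSums 2 B := by
    intro x hx
    exact mem_kSums.2 ⟨Multiset.replicate 2 x, Multiset.le_count_iff_replicate_le.1 hx, by simp,
      by simp⟩
  have hB0 : (0 : G) ∈ B := Multiset.count_pos.1 (by omega)
  have hsub : seqSupport B ⊆ kSums 2 B := by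
    intro x hx
    rw [mem_seqSupport] at hx
    by_cases hx0 : x = 0
    · simpa [hx0] using hdouble 0 h0
    · simpa using hpair x hx 0 hB0 hx0
  refine ⟨Finset.card_le_card hsub, fun hle => ?_⟩
  have heq := Finset.eq_of_subset_of_card_le hsub hle
  rw [← heq] at hpair hdouble
  set S := seqSupport B with hS
  have hS0 : (0 : G) ∈ S := mem_seqSupport.2 hB0
  have hclosed : ∀ a ∈ S, ∀ b ∈ S, a ≠ b → a + b ∈ S := fun a ha b hb hab =>
    hpair a (mem_seqSupport.1 ha) b (mem_seqSupport.1 hb) hab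
  by_cases hall : ∀ a ∈ S, a + a ∈ S
  · left
    refine isSubgroupCoset_iff.2 ⟨⟨⟨⟨(S : Set G), ?_⟩, ?_⟩, ?_⟩, 0, fun x => ?_⟩
    · intro a b ha hb
      by_cases hab : a = b
      · exact hab ▸ hall a ha
      · exact hclosed a ha b hb hab
    · exact hS0
    · intro a ha
      exact neg_mem_of_add_self_mem hclosed ha (hall a ha)
    · rw [sub_zero]; rfl
  · push Not at hall
    obtain ⟨a, ha, haa⟩ := hall
    have hthree := subset_of_add_self_notMem hclosed hS0 ha haa
    have ha0 : a ≠ 0 := by rintro rfl; simp [hS0] at haa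
    have haa0 : a + a ≠ 0 := fun h => haa (h ▸ hS0)
    have hrep : repeated 2 B = {0} := by
      ext x
      rw [mem_repeated_two, Finset.mem_singleton]
      refine ⟨fun hx => ?_, fun hx => hx ▸ h0⟩
      have hxx := hdouble x hx
      rcases hthree x (mem_seqSupport.2 (Multiset.count_pos.1 (by omega))) with h | h | h
      · exact h
      · exact absurd (h ▸ hxx) haa
      · subst h
        exfalso
        rcases hthree _ hxx with h | h | h
        · exact haa0 (by rw [← neg_eq_zero, neg_add]; exact h)
        · refine haa ?_
          have : a + a = -a := by nth_rewrite 1 [← h]; abel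
          rw [this]
          exact mem_seqSupport.2 (Multiset.count_pos.1 (by omega))
        · exact ha0 (by simpa using h)
    right
    by_cases hna : -a ∈ S
    · right
      have hna1 : -a ≠ a := fun h => haa0 (by nth_rewrite 1 [← h]; simp)
      have hSeq : S = {-a, 0, a} := by
        ext x
        simp only [Finset.mem_insert, Finset.mem_singleton]
        constructor
        · intro hx
          have := hthree x hx
          tauto
        · rintro (rfl | rfl | rfl) <;> assumption
      refine ⟨-a, a, ?_, ?_, ?_⟩
      · rw [← hS, hSeq, Finset.card_eq_three]
        exact ⟨-a, 0, a, by simpa using ha0, hna1, Ne.symm ha0, rfl⟩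
      · rw [← hS, hSeq, neg_add_cancel, two_smul, neg_add_cancel_left]
      · rw [hrep, neg_add_cancel]
    · left
      refine ⟨?_, by rw [hrep, Finset.card_singleton]⟩
      have hSeq : S = {0, a} := by
        ext x
        simp only [Finset.mem_insert, Finset.mem_singleton]
        constructor
        · intro hx
          rcases hthree x hx with h | h | h
          · exact Or.inl h
          · exact Or.inr h
          · exact absurd (h ▸ hx) hna
        · rintro (rfl | rfl) <;> assumption
      rw [← hS, hSeq, Finset.card_pair (Ne.symm ha0)]

/-! ### Large subsets of finite groups and single cosets -/

/-- In a finite group, a set `X` of more than half the elements (with a margin of two) represents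
every element as a sum of three distinct terms. If this fails for `c`, then every `c - z` with
`z ∈ X` is a double and doubling is not injective, which is too many doubles. -/
theorem exists_three_sum {G : Type*} [AddCommGroup G] [DecidableEq G] {H : AddSubgroup G}
    {F X : Finset G} (hF : ∀ x, x ∈ F ↔ x ∈ H) (hXF : X ⊆ F) (hcard : F.card + 4 ≤ 2 * X.card)
    {c : G} (hc : c ∈ H) :
    ∃ x ∈ X, ∃ y ∈ X, ∃ z ∈ X, x ≠ y ∧ x ≠ z ∧ y ≠ z ∧ x + y + z = c := by
  by_contra! hcon
  have hhalf : ∀ z ∈ X, ∃ y₁ y₂, y₁ ∈ F ∧ y₂ ∈ F ∧ y₁ ≠ y₂ ∧ y₁ + y₁ = c - z ∧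
      y₂ + y₂ = c - z := by
    intro z hz
    set Y := X.erase z with hY
    have hYc : Y.card = X.card - 1 := Finset.card_erase_of_mem hz
    have hYF : Y ⊆ F := (Finset.erase_subset _ _).trans hXF
    set W := Y.image (fun y => c - z - y) with hW
    have hWc : W.card = Y.card := Finset.card_image_of_injective _ sub_right_injective
    have hWF : W ⊆ F := by
      intro w hw
      obtain ⟨y, hy, rfl⟩ := Finset.mem_image.1 hw
      exact (hF _).2 (H.sub_mem (H.sub_mem hc ((hF z).1 (hXF hz))) ((hF y).1 (hYF hy)))
    have hun := Finset.card_le_card (Finset.union_subset hYF hWF)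
    have hui := Finset.card_union_add_card_inter Y W
    obtain ⟨y₁, h₁, y₂, h₂, hne⟩ := Finset.one_lt_card.1 (show 1 < (Y ∩ W).card by omega)
    have hd : ∀ y ∈ Y ∩ W, y + y = c - z := by
      intro y hy
      obtain ⟨hyY, hyW⟩ := Finset.mem_inter.1 hy
      obtain ⟨y', hy', hyy⟩ := Finset.mem_image.1 hyW
      have hsum : y' + y = c - z := by rw [← hyy]; abel
      by_cases he : y' = y
      · rwa [he] at hsum
      · exact absurd (by rw [hsum]; abel) (hcon y' (Finset.mem_of_mem_erase hy') y
          (Finset.mem_of_mem_erase hyY) z hz he (Finset.ne_of_mem_erase hy')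
          (Finset.ne_of_mem_erase hyY))
    exact ⟨y₁, y₂, hYF (Finset.mem_inter.1 h₁).1, hYF (Finset.mem_inter.1 h₂).1, hne,
      hd _ h₁, hd _ h₂⟩
  choose! u v hu hv huv hu2 hv2 using hhalf
  have huinj : Set.InjOn u X := by
    intro z hz z' hz' h
    have h1 := hu2 z hz
    rw [h, hu2 z' hz'] at h1
    simpa using h1.symm
  have hvinj : Set.InjOn v X := by
    intro z hz z' hz' h
    have h1 := hv2 z hz
    rw [h, hv2 z' hz'] at h1
    simpa using h1.symm
  have hdisj : Disjoint (X.image u) (X.image v) := by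
    rw [Finset.disjoint_left]
    intro w hw hw'
    obtain ⟨z, hz, rfl⟩ := Finset.mem_image.1 hw
    obtain ⟨z', hz', he⟩ := Finset.mem_image.1 hw'
    have h1 := hv2 z' hz'
    rw [he, hu2 z hz] at h1
    have h2 : z = z' := by simpa using h1
    subst h2
    exact huv z hz he.symm
  have hle := Finset.card_le_card (Finset.union_subset (s := X.image u) (t := X.image v) (u := F)
    (Finset.image_subset_iff.2 hu) (Finset.image_subset_iff.2 hv))
  rw [Finset.card_union_of_disjoint hdisj, Finset.card_image_of_injOn huinj,
    Finset.card_image_of_injOn hvinj] at hle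
  omega

theorem sum_mem_kSums {G : Type*} [AddCommGroup G] [DecidableEq G] {S Q : Finset G} (h : Q ⊆ S) :
    ∑ x ∈ Q, x ∈ kSums Q.card S.val :=
  mem_kSums.2 ⟨Q.val, Finset.val_le_iff.2 h, rfl, by
    rw [Finset.sum_eq_multiset_sum, Multiset.map_id']⟩

/-- A set missing at most one element of a finite group has the whole group as set of `k`-sums. -/
theorem mem_kSums_of_card_le {G : Type*} [AddCommGroup G] [DecidableEq G] {H : AddSubgroup G}
    {F S : Finset G} {k : ℕ} (hF : ∀ x, x ∈ F ↔ x ∈ H) (hSF : S ⊆ F) (hcard : F.card ≤ S.card + 1)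
    (hk : 3 ≤ k) (hkS : 2 * k ≤ S.card + 1) {f : G} (hf : f ∈ H) : f ∈ kSums k S.val := by
  obtain ⟨Q, hQS, hQ⟩ := Finset.exists_subset_card_eq (show k - 3 ≤ S.card by omega)
  have hX : (S \ Q).card = S.card - (k - 3) := by rw [Finset.card_sdiff_of_subset hQS, hQ]
  have hQH : ∑ x ∈ Q, x ∈ H := H.sum_mem fun x hx => (hF x).1 (hSF (hQS hx))
  obtain ⟨x, hx, y, hy, z, hz, hxy, hxz, hyz, hsum⟩ := exists_three_sum hF
    (Finset.sdiff_subset.trans hSF : S \ Q ⊆ F) (by omega) (H.sub_mem hf hQH)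
  rw [Finset.mem_sdiff] at hx hy hz
  have hmem := sum_mem_kSums (S := S) (Q := insert x (insert y (insert z Q))) (by
    simp only [Finset.insert_subset_iff]
    exact ⟨hx.1, hy.1, hz.1, hQS⟩)
  have hz' : z ∉ Q := hz.2
  have hy' : y ∉ insert z Q := by simp [hyz, hy.2]
  have hx' : x ∉ insert y (insert z Q) := by simp [hxy, hxz, hx.2]
  rw [Finset.card_insert_of_notMem hx', Finset.card_insert_of_notMem hy',
    Finset.card_insert_of_notMem hz', Finset.sum_insert hx', Finset.sum_insert hy',
    Finset.sum_insert hz', hQ, show k - 3 + 1 + 1 + 1 = k by omega] at hmem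
  convert hmem using 1
  rw [← sub_add_cancel f (∑ x ∈ Q, x), ← hsum]
  abel

/-- A finite set stable under translation by more than half as many elements is a single coset. -/
theorem exists_addSubgroup_of_stable {G : Type*} [AddCommGroup G] [DecidableEq G]
    {Γ D : Finset G} (hst : ∀ d ∈ D, ∀ g, g + d ∈ Γ ↔ g ∈ Γ) (hcard : Γ.card < 2 * D.card) :
    ∃ H : AddSubgroup G, (∀ d ∈ D, d ∈ H) ∧ ∀ γ ∈ Γ, ∀ g, g ∈ Γ ↔ g - γ ∈ H := by
  let H : AddSubgroup G :=
    { carrier := {h | ∀ g, g + h ∈ Γ ↔ g ∈ Γ}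
      zero_mem' := by simp
      add_mem' := by
        intro a b ha hb g
        rw [← add_assoc, hb, ha]
      neg_mem' := by
        intro a ha g
        rw [← ha (g + -a), neg_add_cancel_right] }
  have hH : ∀ h, h ∈ H ↔ ∀ g, g + h ∈ Γ ↔ g ∈ Γ := fun _ => Iff.rfl
  refine ⟨H, hst, fun γ hγ g => ⟨fun hg => ?_, fun hg => ?_⟩⟩
  · by_contra hcon
    have hdisj : Disjoint (D.image (γ + ·)) (D.image (g + ·)) := by
      rw [Finset.disjoint_left]
      intro w hw hw'
      obtain ⟨d, hd, rfl⟩ := Finset.mem_image.1 hw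
      obtain ⟨e, he, hde⟩ := Finset.mem_image.1 hw'
      refine hcon ?_
      have h1 : g - γ = d - e := by
        rw [sub_eq_sub_iff_add_eq_add]
        exact hde.trans (add_comm γ d)
      rw [h1]
      exact H.sub_mem (hst d hd) (hst e he)
    have hle := Finset.card_le_card (Finset.union_subset (s := D.image (γ + ·))
      (t := D.image (g + ·)) (u := Γ)
      (Finset.image_subset_iff.2 fun d hd => (hst d hd γ).2 hγ)
      (Finset.image_subset_iff.2 fun d hd => (hst d hd g).2 hg))
    rw [Finset.card_union_of_disjoint hdisj, Finset.card_image_of_injective _ (add_right_injective γ),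
      Finset.card_image_of_injective _ (add_right_injective g)] at hle
    omega
  · have := ((hH _).1 hg γ).2 hγ
    rwa [add_sub_cancel] at this

/-- The case of a sequence `0, S` whose set of `k`-sums loses at most one element under translation
by the difference of any two nonzero elements of `S`. -/
theorem isSubgroupCoset_of_almost_stable {G : Type*} [AddCommGroup G] [DecidableEq G]
    {S : Finset G} {k : ℕ} (h0 : (0 : G) ∈ S) (hS : 5 ≤ S.card) (hk : 3 ≤ k)
    (hkS : 2 * k ≤ S.card + 1) (hle : (kSums k (0 ::ₘ S.val)).card ≤ S.card)
    (hP : ∀ x ∈ S.erase 0, ∀ y ∈ S.erase 0, ∀ p ∈ kSums k (0 ::ₘ S.val),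
      ∀ q ∈ kSums k (0 ::ₘ S.val), p + (x - y) ∉ kSums k (0 ::ₘ S.val) →
        q + (x - y) ∉ kSums k (0 ::ₘ S.val) → p = q) :
    S.card ≤ (kSums k (0 ::ₘ S.val)).card ∧ IsSubgroupCoset (S : Set G) := by
  have hSK : kSums k S.val ⊆ kSums k (0 ::ₘ S.val) := kSums_mono (Multiset.le_cons_self _ _)
  -- sums of `k` or, using the additional `0`, of `k - 1` nonzero terms
  have hsum : ∀ Q ⊆ S, Q.card = k ∨ Q.card + 1 = k → ∑ x ∈ Q, x ∈ kSums k (0 ::ₘ S.val) := by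
    rintro Q hQ (h | h)
    · exact hSK (h ▸ sum_mem_kSums hQ)
    · have := add_mem_kSums (le_refl (0 ::ₘ S.val)) (sum_mem_kSums hQ)
      rwa [zero_add, h] at this
  set K := kSums k (0 ::ₘ S.val) with hK
  set T := S.erase 0 with hT
  have hTc : T.card = S.card - 1 := Finset.card_erase_of_mem h0
  have hTS : T ⊆ S := Finset.erase_subset _ _
  obtain ⟨Q, hQT, hQ⟩ := Finset.exists_subset_card_eq (show k - 2 ≤ T.card by omega)
  obtain ⟨a, ha, b, hb, c, hc, hab, hac, hbc⟩ := Finset.two_lt_card.1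
    (show 2 < (T \ Q).card by rw [Finset.card_sdiff_of_subset hQT]; omega)
  rw [Finset.mem_sdiff] at ha hb hc
  set s := ∑ x ∈ Q, x with hs
  have hone : ∀ z ∈ T, z ∉ Q → s + z ∈ K := by
    intro z hz hzQ
    have := hsum (insert z Q) (Finset.insert_subset (hTS hz) (hQT.trans hTS)) (by
      rw [Finset.card_insert_of_notMem hzQ]; omega)
    rwa [Finset.sum_insert hzQ, add_comm] at this
  have htwo : ∀ z ∈ T, z ∉ Q → a ≠ z → s + a + z ∈ K := by
    intro z hz hzQ haz
    have haQ : a ∉ insert z Q := by simp [haz, ha.2]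
    have := hsum (insert a (insert z Q)) (Finset.insert_subset (hTS ha.1)
      (Finset.insert_subset (hTS hz) (hQT.trans hTS))) (by
      rw [Finset.card_insert_of_notMem haQ, Finset.card_insert_of_notMem hzQ]; omega)
    rw [Finset.sum_insert haQ, Finset.sum_insert hzQ] at this
    convert this using 1
    abel
  have k1 := hone a ha.1 ha.2
  have k2 := hone b hb.1 hb.2
  have k3 := htwo b hb.1 hb.2 hab
  have k4 := htwo c hc.1 hc.2 hac
  set D := T.image (· - a) with hD
  have hDc : D.card = T.card := Finset.card_image_of_injective _ sub_left_injective
  obtain ⟨Γ, hΓ, hst⟩ := exists_stable_of_almost_stable (K := K) (D := D)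
    (Finset.mem_image.2 ⟨a, ha.1, sub_self a⟩) (by omega) (by
      intro d hd e he p hp q hq
      obtain ⟨x, hx, rfl⟩ := Finset.mem_image.1 hd
      obtain ⟨y, hy, rfl⟩ := Finset.mem_image.1 he
      rw [sub_sub_sub_cancel_right]
      exact hP x hx y hy p hp q hq)
  have hΓc : Γ.card ≤ K.card + 1 := by
    rcases hΓ with rfl | ⟨f, -, rfl⟩ | ⟨u, -, rfl⟩
    · omega
    · exact Finset.card_insert_le _ _
    · exact (Finset.card_erase_le).trans (Nat.le_succ _)
  obtain ⟨H, hDH, hH⟩ := exists_addSubgroup_of_stable hst (by omega)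
  have hdiff : ∀ x ∈ T, x - a ∈ H := fun x hx => hDH _ (Finset.mem_image_of_mem _ hx)
  have hSH : a ∈ H → ∀ x ∈ S, x ∈ H := by
    intro haH x hx
    by_cases hx0 : x = 0
    · exact hx0 ▸ H.zero_mem
    · have := H.add_mem (hdiff x (Finset.mem_erase.2 ⟨hx0, hx⟩)) haH
      rwa [sub_add_cancel] at this
  have haH : ∀ p ∈ Γ, ∀ q ∈ Γ, p - q = a → a ∈ H := fun p hp q hq h => h ▸ (hH q hq p).1 hp
  have hshift : a ∈ H → ∀ γ ∈ Γ, S.image (· + γ) ⊆ Γ := by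
    intro h γ hγ
    refine Finset.image_subset_iff.2 fun x hx => (hH γ hγ _).2 ?_
    rw [add_sub_cancel_right]
    exact hSH h x hx
  have hSc : ∀ γ, (S.image (· + γ)).card = S.card := fun γ =>
    Finset.card_image_of_injective _ (add_left_injective γ)
  rcases hΓ with rfl | ⟨f, hf, rfl⟩ | ⟨u, hu, rfl⟩
  · -- `K` is a coset of `H`, which is then `S`
    have ha' : a ∈ H := haH _ k3 _ k2 (by abel)
    have hsub := hshift ha' _ k1
    have hc1 := Finset.card_le_card hsub
    rw [hSc] at hc1
    have heq := Finset.eq_of_subset_of_card_le hsub (by rw [hSc]; exact hle)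
    refine ⟨hc1, isSubgroupCoset_iff.2 ⟨H, 0, fun x => ?_⟩⟩
    rw [sub_zero]
    refine ⟨fun hx => hSH ha' x hx, fun hx => ?_⟩
    have h1 := (hH _ k1 (x + (s + a))).2 (by rwa [add_sub_cancel_right])
    rw [← heq] at h1
    obtain ⟨y, hy, hyx⟩ := Finset.mem_image.1 h1
    exact add_right_cancel hyx ▸ hy
  · -- `K` is a coset of `H` minus a point, although it contains all of `H`
    exfalso
    have k1' := Finset.mem_insert_of_mem (b := f) k1
    have ha' : a ∈ H := haH _ (Finset.mem_insert_of_mem k3) _ (Finset.mem_insert_of_mem k2)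
      (by abel)
    have hsH : s + a ∈ H :=
      H.add_mem (H.sum_mem fun x hx => hSH ha' x (hTS (hQT hx))) ha'
    have hmem : ∀ x, x ∈ insert f K ↔ x ∈ H := by
      intro x
      rw [hH _ k1' x]
      exact ⟨fun h => by simpa using H.add_mem h hsH, fun h => H.sub_mem h hsH⟩
    exact hf (hSK (mem_kSums_of_card_le hmem (fun x hx => (hmem x).2 (hSH ha' x hx))
      (hΓc.trans (by omega)) hk hkS ((hmem f).1 (Finset.mem_insert_self _ _))))
  · -- `K` is a coset of `H` and one more point, although it meets two cosets in two points each
    exfalso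
    have key : ∀ p ∈ K.erase u, ∀ q ∈ K.erase u, p - q - a ∈ H → False := by
      intro p hp q hq hpq
      have h1 := H.sub_mem ((hH q hq p).1 hp) hpq
      rw [sub_sub_cancel] at h1
      have h2 := Finset.card_le_card (hshift h1 p hp)
      rw [hSc, Finset.card_erase_of_mem hu] at h2
      omega
    have hb' := hdiff b hb.1
    have hc' := hdiff c hc.1
    obtain ⟨q, hq, hqs⟩ : ∃ q ∈ K.erase u, q - (s + a) ∈ H := by
      by_cases h : s + a = u
      · refine ⟨s + b, Finset.mem_erase.2 ⟨fun h' => hab ?_, k2⟩, by simpa using hb'⟩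
        exact add_left_cancel (h.trans h'.symm)
      · exact ⟨s + a, Finset.mem_erase.2 ⟨h, k1⟩, by simp⟩
    obtain ⟨p, hp, hps⟩ : ∃ p ∈ K.erase u, p - (s + a + a) ∈ H := by
      by_cases h : s + a + b = u
      · refine ⟨s + a + c, Finset.mem_erase.2 ⟨fun h' => hbc ?_, k4⟩, by simpa using hc'⟩
        exact add_left_cancel (h.trans h'.symm)
      · exact ⟨s + a + b, Finset.mem_erase.2 ⟨h, k3⟩, by simpa using hb'⟩
    refine key p hp q hq ?_
    have := H.sub_mem hps hqs
    convert this using 1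
    abel

/-! ### Sequences with a single repetition -/

theorem seqSupport_zero_cons {G : Type*} [AddCommGroup G] [DecidableEq G] {S : Finset G}
    (h0 : (0 : G) ∈ S) : seqSupport (0 ::ₘ S.val) = S := by
  ext x
  rw [mem_seqSupport, Multiset.mem_cons, Finset.mem_val]
  exact ⟨fun h => h.elim (fun h => h ▸ h0) id, Or.inr⟩

theorem kSums_two_subset_three {G : Type*} [AddCommGroup G] [DecidableEq G] {S : Finset G}
    (h0 : (0 : G) ∈ S) (h : (0 : G) ∈ kSums 3 (0 ::ₘ S.val)) :
    kSums 2 (0 ::ₘ S.val) ⊆ kSums 3 (0 ::ₘ S.val) := by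
  intro g hg
  obtain ⟨B, hB, hB2, rfl⟩ := mem_kSums.1 hg
  by_cases h0B : (0 : G) ∈ B
  · obtain ⟨C, rfl⟩ := Multiset.exists_cons_of_mem h0B
    obtain ⟨b, rfl⟩ := Multiset.card_eq_one.1 (show C.card = 1 by simpa using hB2)
    by_cases hb : b = 0
    · simpa [hb] using h
    · have hbS : b ∈ S := by
        have := (Multiset.cons_le_cons_iff (0 : G)).1 hB
        simpa using this
      refine mem_kSums.2 ⟨0 ::ₘ 0 ::ₘ {b}, (Multiset.cons_le_cons_iff 0).2 ?_, by simp, by simp⟩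
      rw [Multiset.cons_le_of_notMem (by simpa using Ne.symm hb)]
      exact ⟨h0, Multiset.singleton_le.2 hbS⟩
  · rw [Multiset.le_cons_of_notMem h0B] at hB
    exact mem_kSums.2 ⟨0 ::ₘ B, (Multiset.cons_le_cons_iff 0).2 hB, by simp [hB2], by simp⟩

/-- A sequence with a single repetition, translated to `0`: the bound for `k` follows from the
bound for the sequences obtained by deleting two nonzero terms. -/
theorem kSumsBound_zero_cons {G : Type*} [AddCommGroup G] [DecidableEq G] {S : Finset G} {k : ℕ}
    (h0 : (0 : G) ∈ S) (hS : 5 ≤ S.card) (hk : 3 ≤ k) (hkS : 2 * k ≤ S.card + 1)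
    (ih : ∀ S' : Finset G, (0 : G) ∈ S' → S'.card + 2 = S.card → ∀ j, 2 ≤ j →
      j + 1 ≤ S'.card → KSumsBound (0 ::ₘ S'.val) j) :
    KSumsBound (0 ::ₘ S.val) k := by
  rw [KSumsBound, seqSupport_zero_cons h0]
  suffices h : (kSums k (0 ::ₘ S.val)).card ≤ S.card →
      S.card ≤ (kSums k (0 ::ₘ S.val)).card ∧ IsExtremal (0 ::ₘ S.val) by
    exact ⟨(le_total _ _).elim (fun hle => (h hle).1) id, fun hle => (h hle).2⟩
  intro hle
  -- `S` with two nonzero elements removed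
  have hdel : ∀ x ∈ S.erase 0, ∀ y ∈ S.erase 0, x ≠ y → ∃ S' : Finset G, (0 : G) ∈ S' ∧
      S'.card + 2 = S.card ∧
      x ::ₘ 0 ::ₘ S'.val ≤ 0 ::ₘ S.val ∧ y ::ₘ 0 ::ₘ S'.val ≤ 0 ::ₘ S.val := by
    intro x hx y hy hxy
    rw [Finset.mem_erase] at hx hy
    have hins : ∀ z ∈ S, z ∉ (S.erase x).erase y →
        z ::ₘ 0 ::ₘ ((S.erase x).erase y).val ≤ 0 ::ₘ S.val := by
      intro z hz hzn
      rw [Multiset.cons_swap, Multiset.cons_le_cons_iff, ← Finset.insert_val_of_notMem hzn,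
        Finset.val_le_iff]
      exact Finset.insert_subset hz ((Finset.erase_subset _ _).trans (Finset.erase_subset _ _))
    have hyx : y ∈ S.erase x := Finset.mem_erase.2 ⟨hxy.symm, hy.2⟩
    refine ⟨(S.erase x).erase y, ?_, ?_, hins x hx.2 ?_, hins y hy.2 ?_⟩
    · simp [h0, hx.1.symm, hy.1.symm]
    · rw [Finset.card_erase_of_mem hyx, Finset.card_erase_of_mem hx.2]
      omega
    all_goals simp
  by_cases hsmall : ∀ x ∈ S.erase 0, ∀ y ∈ S.erase 0, x ≠ y → ∀ S' : Finset G, (0 : G) ∈ S' →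
      S'.card + 2 = S.card → x ::ₘ 0 ::ₘ S'.val ≤ 0 ::ₘ S.val →
      y ::ₘ 0 ::ₘ S'.val ≤ 0 ::ₘ S.val → S.card ≤ (kSums (k - 1) (0 ::ₘ S'.val)).card + 1
  · have := isSubgroupCoset_of_almost_stable h0 hS hk hkS hle (by
      intro x hx y hy p hp q hq hpn hqn
      by_cases hxy : x = y
      · simp [hxy, hp] at hpn
      obtain ⟨S', h0', hc', hxS, hyS⟩ := hdel x hx y hy hxy
      have hZ := hsmall x hx y hy hxy S' h0' hc' hxS hyS
      set Z := kSums (k - 1) (0 ::ₘ S'.val) with hZdef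
      have hk1 : k - 1 + 1 = k := by omega
      have hyZ : Z.image (y + ·) ⊆ kSums k (0 ::ₘ S.val) := by
        refine Finset.image_subset_iff.2 fun z hz => ?_
        have := add_mem_kSums hyS hz
        rwa [hk1] at this
      have hout : ∀ g, g + (x - y) ∉ kSums k (0 ::ₘ S.val) → g ∉ Z.image (y + ·) := by
        intro g hg hgZ
        obtain ⟨z, hz, rfl⟩ := Finset.mem_image.1 hgZ
        refine hg ?_
        have := add_mem_kSums hxS hz
        rw [hk1] at this
        convert this using 1
        abel
      by_contra hpq
      -- `y + Z`, `p` and `q` are too many elements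
      have hcard := Finset.card_le_card (Finset.insert_subset hp (Finset.insert_subset hq hyZ))
      rw [Finset.card_insert_of_notMem (by simp only [Finset.mem_insert, not_or]; exact
          ⟨hpq, hout p hpn⟩), Finset.card_insert_of_notMem (hout q hqn),
        Finset.card_image_of_injective _ (add_right_injective y)] at hcard
      omega)
    refine ⟨this.1, Or.inl ?_⟩
    rw [seqSupport_zero_cons h0]
    exact this.2
  push Not at hsmall
  obtain ⟨x, hx, y, hy, hxy, S', h0', hc', hxS, hyS, hZ⟩ := hsmall
  have hk1 : k - 1 + 1 = k := by omega
  have hA' : 0 ::ₘ S'.val ≤ 0 ::ₘ S.val := (Multiset.le_cons_self _ _).trans hxS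
  by_cases hS5 : S.card = 5
  · -- here `S'` has three elements `0, p, q`, and `p + q = 0`
    obtain rfl : k = 3 := by omega
    have hsub : S' ⊆ kSums 2 (0 ::ₘ S'.val) := by
      intro z hz
      refine mem_kSums.2 ⟨0 ::ₘ {z}, (Multiset.cons_le_cons_iff 0).2
        (Multiset.singleton_le.2 hz), by simp, by simp⟩
    have heq := Finset.eq_of_subset_of_card_le hsub (by simp only [Nat.add_one_sub_one] at hZ; omega)
    obtain ⟨p, q, hpq, hpqS⟩ := Finset.card_eq_two.1
      (show (S'.erase 0).card = 2 by rw [Finset.card_erase_of_mem h0']; omega)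
    have hp : p ≠ 0 ∧ p ∈ S' := Finset.mem_erase.1 (by simp [hpqS])
    have hq : q ≠ 0 ∧ q ∈ S' := Finset.mem_erase.1 (by simp [hpqS])
    have hpqle : ({p, q} : Multiset G) ≤ S'.val := by
      rw [Multiset.insert_eq_cons, Multiset.cons_le_of_notMem (by simpa using hpq)]
      exact ⟨hp.2, Multiset.singleton_le.2 hq.2⟩
    have hsum : p + q = 0 := by
      have hmem : p + q ∈ S' := by
        rw [heq]
        exact mem_kSums.2 ⟨{p, q}, hpqle.trans (Multiset.le_cons_self _ _), by simp, by simp⟩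
      by_contra hne
      have : p + q ∈ S'.erase 0 := Finset.mem_erase.2 ⟨hne, hmem⟩
      rw [hpqS] at this
      simp [hp.1, hq.1] at this
    have h03 : (0 : G) ∈ kSums 3 (0 ::ₘ S.val) := by
      refine mem_kSums.2 ⟨0 ::ₘ {p, q}, ?_, by simp, by simp [hsum]⟩
      exact ((Multiset.cons_le_cons_iff 0).2 hpqle).trans hA'
    have hle2 := Finset.card_le_card (kSums_two_subset_three h0 h03)
    have h2 := kSumsBound_two (A := 0 ::ₘ S.val) (by
      rw [seqSupport_zero_cons h0]; simp)
    rw [KSumsBound, seqSupport_zero_cons h0] at h2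
    exact ⟨h2.1.trans hle2, h2.2 (hle2.trans hle)⟩
  · -- here `S'` is a subgroup, and the sums with and without `x` lie in distinct cosets
    exfalso
    have hb1 := ih S' h0' hc' (k - 1) (by omega) (by omega)
    have hb2 := ih S' h0' hc' k (by omega) (by omega)
    rw [KSumsBound, seqSupport_zero_cons h0'] at hb1 hb2
    have hext := hb1.2 (by omega)
    rw [IsExtremal, seqSupport_zero_cons h0'] at hext
    obtain hcos | ⟨h2, -⟩ | ⟨_, _, h3, -⟩ := hext
    · obtain ⟨H, g, hg⟩ := isSubgroupCoset_iff.1 hcos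
      have hgH : g ∈ H := by
        have := (hg 0).1 h0'
        simpa using this
      have hmem : ∀ z, z ∈ S' ↔ z ∈ H := fun z =>
        (hg z).trans ⟨fun h => by simpa using H.add_mem h hgH, fun h => H.sub_mem h hgH⟩
      have hxH : x ∉ H := by
        rw [← hmem]
        intro hxS'
        have h2 := Multiset.count_le_of_le x hxS
        have hx0 : x ≠ 0 := (Finset.mem_erase.1 hx).1
        rw [Multiset.count_cons_self, Multiset.count_cons_of_ne hx0,
          Multiset.count_cons_of_ne hx0] at h2
        have h3 := Multiset.nodup_iff_count_le_one.1 S.nodup x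
        have h4 := Multiset.count_pos.2 (show x ∈ S'.val from hxS')
        omega
      have hin : ∀ j, ∀ z ∈ kSums j (0 ::ₘ S'.val), z ∈ H := by
        intro j z hz
        obtain ⟨B, hB, -, rfl⟩ := mem_kSums.1 hz
        refine H.multiset_sum_mem _ fun b hb => ?_
        rcases Multiset.mem_cons.1 (Multiset.mem_of_le hB hb) with h | h
        · exact h ▸ H.zero_mem
        · exact (hmem b).1 h
      have hdisj : Disjoint (kSums k (0 ::ₘ S'.val))
          ((kSums (k - 1) (0 ::ₘ S'.val)).image (x + ·)) := by
        rw [Finset.disjoint_left]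
        intro w hw hw'
        obtain ⟨z, hz, rfl⟩ := Finset.mem_image.1 hw'
        have := H.sub_mem (hin _ _ hw) (hin _ _ hz)
        rw [add_sub_cancel_right] at this
        exact hxH this
      have hcard := Finset.card_le_card (Finset.union_subset
        (kSums_mono (k := k) hA') (Finset.image_subset_iff.2 (fun z hz => by
          have := add_mem_kSums hxS hz
          rwa [hk1] at this) : (kSums (k - 1) (0 ::ₘ S'.val)).image (x + ·) ⊆
            kSums k (0 ::ₘ S.val)))
      rw [Finset.card_union_of_disjoint hdisj,
        Finset.card_image_of_injective _ (add_right_injective x)] at hcard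
      omega
    · omega
    · omega

/-! ### Reductions and the induction -/

theorem card_le_of_count_le_two {G : Type*} [DecidableEq G] {A : Multiset G}
    (h : ∀ x, A.count x ≤ 2) : A.card ≤ (seqSupport A).card + (repeated 2 A).card := by
  have h1 : A.card = ∑ x ∈ seqSupport A, A.count x := (Multiset.toFinset_sum_count_eq A).symm
  have h2 : (repeated 2 A).card = ∑ x ∈ seqSupport A, if 2 ≤ A.count x then 1 else 0 := by
    rw [repeated, Finset.card_filter]; rfl
  rw [h1, h2, Finset.card_eq_sum_ones, ← Finset.sum_add_distrib]
  refine Finset.sum_le_sum fun x _ => ?_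
  have := h x
  split_ifs <;> omega

/-- Deleting a repeated term does not change the support; a term of maximal multiplicity can be
deleted without creating a new extremal configuration. -/
theorem kSumsBound_of_erase {G : Type*} [AddCommGroup G] [DecidableEq G] {A : Multiset G} {k : ℕ}
    (hA : (seqSupport A).card + 2 ≤ A.card) (hk : 3 ≤ k) (hA6 : 6 ≤ A.card)
    (ih : ∀ x, 2 ≤ A.count x → KSumsBound (A.erase x) (k - 1)) : KSumsBound A k := by
  obtain ⟨x, hx, hmax⟩ : ∃ x, 2 ≤ A.count x ∧ (A.count x = 2 → ∀ y, A.count y ≤ 2) := by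
    by_cases h3 : ∃ x, 3 ≤ A.count x
    · obtain ⟨x, hx⟩ := h3
      exact ⟨x, by omega, by omega⟩
    · push Not at h3
      obtain ⟨r, hr⟩ : ∃ r, 2 ≤ A.count r := by
        by_contra! hcon
        have : A.Nodup := Multiset.nodup_iff_count_le_one.2 fun a => by have := hcon a; omega
        rw [seqSupport, Multiset.toFinset_card_of_nodup this] at hA
        omega
      exact ⟨r, hr, fun _ y => by have := h3 y; omega⟩
  have hxA : x ∈ A := Multiset.count_pos.1 (by omega)
  have hsupp : seqSupport (A.erase x) = seqSupport A := by
    ext y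
    rw [mem_seqSupport, mem_seqSupport]
    refine ⟨Multiset.mem_of_mem_erase, fun hy => ?_⟩
    by_cases hyx : y = x
    · subst hyx
      refine Multiset.count_pos.1 ?_
      rw [Multiset.count_erase_self]; omega
    · exact (Multiset.mem_erase_of_ne hyx).2 hy
  have hb := ih x hx
  rw [KSumsBound, hsupp] at hb
  have hcard : (kSums (k - 1) (A.erase x)).card ≤ (kSums k A).card := by
    refine Finset.card_le_card_of_injOn (x + ·) ?_ (add_right_injective x).injOn
    intro z hz
    have := add_mem_kSums (Multiset.cons_erase hxA).le hz
    rwa [show k - 1 + 1 = k by omega] at this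
  refine ⟨hb.1.trans hcard, fun hle => ?_⟩
  have hext := hb.2 (hcard.trans hle)
  rw [IsExtremal, hsupp] at hext
  by_cases h2 : A.count x = 2
  · -- all multiplicities are at most two, so a single repetition leaves too few terms
    have hA' := card_le_of_count_le_two (A := A.erase x) fun y =>
      (Multiset.count_le_of_le y (Multiset.erase_le x A)).trans (hmax h2 y)
    rw [hsupp, Multiset.card_erase_of_mem hxA, Nat.pred_eq_sub_one] at hA'
    rcases hext with h | ⟨h1, h1'⟩ | ⟨a, d, h1, -, h1'⟩
    · exact Or.inl h
    · omega
    · rw [h1', Finset.card_singleton] at hA'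
      omega
  · have hrep : repeated 2 (A.erase x) = repeated 2 A := by
      ext y
      rw [mem_repeated_two, mem_repeated_two]
      by_cases hyx : y = x
      · subst hyx
        rw [Multiset.count_erase_self]; omega
      · rw [Multiset.count_erase_of_ne hyx]
    rwa [hrep] at hext

/-- A sequence with exactly one repetition is a translate of `0, S` for a finite set `S ∋ 0`. -/
theorem exists_map_add_eq_zero_cons {G : Type*} [AddCommGroup G] [DecidableEq G] {A : Multiset G}
    (hA : A.card = (seqSupport A).card + 1) :
    ∃ (c : G) (S : Finset G), (0 : G) ∈ S ∧ A.map (· + c) = 0 ::ₘ S.val := by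
  obtain ⟨C, hC⟩ := Multiset.le_iff_exists_add.1 (Multiset.dedup_le A)
  have hCc : C.card = 1 := by
    have h1 := congrArg Multiset.card hC
    rw [Multiset.card_add] at h1
    have h2 : (seqSupport A).card = A.dedup.card := rfl
    omega
  obtain ⟨r, rfl⟩ := Multiset.card_eq_one.1 hCc
  have hr : r ∈ A := by rw [hC]; simp
  refine ⟨-r, (seqSupport A).image (· + -r),
    Finset.mem_image.2 ⟨r, mem_seqSupport.2 hr, add_neg_cancel r⟩, ?_⟩
  rw [Finset.image_val_of_injOn (add_left_injective _).injOn]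
  conv_lhs => rw [hC]
  rw [add_comm, Multiset.singleton_add, Multiset.map_cons, add_neg_cancel]
  rfl

theorem kSumsBound_of_card_lt {G : Type*} [AddCommGroup G] [DecidableEq G] (A : Multiset G) (k : ℕ)
    (hA : (seqSupport A).card < A.card) (hk : 2 ≤ k) (hkA : k + 2 ≤ A.card) : KSumsBound A k := by
  induction hn : A.card using Nat.strong_induction_on generalizing A k with
  | _ n ih =>
    subst hn
    by_cases hk2 : k = 2
    · exact hk2 ▸ kSumsBound_two hA
    by_cases hk2' : k + 2 = A.card
    · refine KSumsBound.of_sub (by omega) ?_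
      rw [show A.card - k = 2 by omega]
      exact kSumsBound_two hA
    by_cases hone : A.card = (seqSupport A).card + 1
    · obtain ⟨c, S, h0, hS⟩ := exists_map_add_eq_zero_cons hone
      have hSc : A.card = S.card + 1 := by
        have := congrArg Multiset.card hS
        simpa using this
      have main : ∀ j, 3 ≤ j → 2 * j ≤ A.card → KSumsBound A j := by
        intro j hj hj2
        refine KSumsBound.of_map_add c ?_
        rw [hS]
        refine kSumsBound_zero_cons h0 (by omega) hj (by omega) fun S' h0' hc' i hi hi' => ?_
        have hcard : (0 ::ₘ S'.val).card = S'.card + 1 := by simp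
        exact ih _ (by omega) (0 ::ₘ S'.val) i (by rw [seqSupport_zero_cons h0']; omega) hi
          (by omega) rfl
      by_cases hhalf : 2 * k ≤ A.card
      · exact main k (by omega) hhalf
      · exact KSumsBound.of_sub (by omega) (main _ (by omega) (by omega))
    · refine kSumsBound_of_erase (by omega) (by omega) (by omega) fun x hx => ?_
      have hxA : x ∈ A := Multiset.count_pos.1 (by omega)
      have hcard : (A.erase x).card = A.card - 1 := Multiset.card_erase_of_mem hxA
      have hsupp : (seqSupport (A.erase x)).card ≤ (seqSupport A).card :=
        Finset.card_le_card (Multiset.toFinset_subset.2 (Multiset.erase_subset x A))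
      exact ih _ (by omega) (A.erase x) (k - 1) (by omega) (by omega) (by omega) rfl

theorem mainTheorem2 {G : Type*} [AddCommGroup G] [DecidableEq G] (A : Multiset G) (k : ℕ)
    (hA : (seqSupport A).card < A.card) (hk : 2 ≤ k) (hkA : k + 2 ≤ A.card) :
    (seqSupport A).card ≤ (kSums k A).card ∧
    ((kSums k A).card = (seqSupport A).card ↔
      (IsSubgroupCoset (seqSupport A : Set G) ∨
       ((seqSupport A).card = 2 ∧ (repeated 2 A).card = 1) ∨
       (∃ a d : G, (seqSupport A).card = 3 ∧ seqSupport A = {a, a + d, a + 2 • d} ∧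
          repeated 2 A = {a + d}))) := by
  obtain ⟨hle, hext⟩ := kSumsBound_of_card_lt A k hA hk hkA
  exact ⟨hle, fun h => hext h.le, fun h => le_antisymm (IsExtremal.card_kSums_le h k) hle⟩
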